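/- Let $n\ge 1$. For a partition $\lambda=(\lambda_1\ge\dots\ge\lambda_n\ge 0)$ let $$s_\lambda(x)=\frac{\det(x_i^{\lambda_j+n-j})}{\det(x_i^{n-j})},\qquad \bar s_\lambda(x)=\frac{s_\lambda(x)}{s_\lambda(1,\dots,1)},\qquad q_\lambda(z)=\bar s_\lambda(z,1,\dots,1)$$ be the Schur polynomial, the normalized Schur polynomial, and the polynomial obtained from it by setting all variables but one equal to $1$. For $z\in\mathbb{C}$ let $Q_z$ be the linear operator on $\mathbb{C}[x_1,\dots,x_n]^{S_n}$ defined by $Q_z\bar s_\lambda=q_\lambda(z)\,\bar s_\lambda$ for all $\lambda$, and let $\Delta_n(x)=\prod_{i<j}(x_i-x_j)$. Let $z>1$ be real and let $0<y_1<y_2<\dots<y_n$ be real numbers. Then for every $f\in\mathbb{C}[x_1,\dots,x_n]^{S_n}$ $$[Q_zf](y)=\frac{(n-1)!}{(z-1)^{n-1}\,\Delta_n(y)}\int_{\Omega}\delta(x_1\cdots x_n-z\,y_1\cdots y_n)\,\Delta_n(x)\,f(x)\,dx,$$ where $$\Omega=\{x\in\mathbb{R}^n:\ y_1<x_1<y_2<x_2<\dots<x_{n-1}<y_n<x_n\}$$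 and the integral with the Dirac delta function exists in the following sense: for every continuous compactly supported $\varphi:\mathbb{R}\to\mathbb{R}$ with $\int\varphi=1$, the integrand obtained by replacing $\delta(t)$ by $\varepsilon^{-1}\varphi(t/\varepsilon)$ is integrable over $\Omega$ for all small $\varepsilon>0$, and the resulting integrals converge, as $\varepsilon\to 0^+$, to a limit independent of $\varphi$, which is the value of the integral above. -/

import Mathlib

open MvPolynomial Filter Topology MeasureTheory

namespace SchurQ

/-- Symmetric polynomials in `x_1, …, x_n` with complex coefficients. -/
abbrev Sym (n : ℕ) : Type := symmetricSubalgebra (Fin n) ℂ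

/-- Partitions `λ_1 ≥ λ_2 ≥ … ≥ λ_n ≥ 0` of length `n` (zero parts allowed). -/
abbrev Part (n : ℕ) : Type := {l : Fin n → ℕ // Antitone l}

/-- The staircase `δ = (n-1, n-2, …, 0)`. -/
def delta (n : ℕ) (i : Fin n) : ℕ := n - 1 - i

/-- The alternant `a_μ = det (x_i ^ μ_j)`. -/
noncomputable def alternant {n : ℕ} (μ : Fin n → ℕ) : MvPolynomial (Fin n) ℂ :=
  (Matrix.of fun i j => (X i : MvPolynomial (Fin n) ℂ) ^ μ j).det

/-- The shifted partition `μ = λ + δ`. -/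
def shifted {n : ℕ} (l : Part n) (i : Fin n) : ℕ := l.1 i + delta n i

/-- The Vandermonde product `Δ_n(x) = ∏_{i<j} (x_i - x_j)`. -/
def vandermondeProd {R : Type*} [CommRing R] {n : ℕ} (x : Fin n → R) : R :=
  ∏ i, ∏ j ∈ Finset.Ioi i, (x i - x j)

theorem alternant_delta (n : ℕ) :
    alternant (delta n) = vandermondeProd (fun i : Fin n => (X i : MvPolynomial (Fin n) ℂ)) := by
  have h1 : alternant (delta n) =
      (Matrix.vandermonde (fun i : Fin n => (X (Fin.rev i) : MvPolynomial (Fin n) ℂ))).det := by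
    rw [← Matrix.det_submatrix_equiv_self Fin.revPerm]
    unfold alternant
    congr 1
    ext1 i j
    simp only [Matrix.of_apply, Matrix.submatrix_apply, Matrix.vandermonde_apply,
      Fin.revPerm_apply, Fin.rev_rev, delta, Fin.val_rev]
    congr 1
    omega
  rw [h1, Matrix.det_vandermonde, vandermondeProd, Finset.prod_sigma', Finset.prod_sigma']
  refine Finset.prod_bij' (fun p _ => ⟨Fin.rev p.2, Fin.rev p.1⟩)
    (fun p _ => ⟨Fin.rev p.2, Fin.rev p.1⟩) ?_ ?_ ?_ ?_ ?_ <;> simp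

theorem X_sub_X_dvd_alternant {n : ℕ} (μ : Fin n → ℕ) {i j : Fin n} (h : i ≠ j) :
    (X i - X j : MvPolynomial (Fin n) ℂ) ∣ alternant μ := by
  rw [← Ideal.mem_span_singleton, ← Ideal.Quotient.eq_zero_iff_mem, alternant, RingHom.map_det]
  refine Matrix.det_zero_of_row_eq h ?_
  have hx : (Ideal.Quotient.mk (Ideal.span {(X i - X j : MvPolynomial (Fin n) ℂ)})) (X i) =
      (Ideal.Quotient.mk (Ideal.span {(X i - X j : MvPolynomial (Fin n) ℂ)})) (X j) := by
    rw [Ideal.Quotient.eq]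
    exact Ideal.mem_span_singleton_self _
  funext k
  simp [hx]

theorem X_sub_X_irreducible {n : ℕ} {i j : Fin n} (h : i ≠ j) :
    Irreducible (X i - X j : MvPolynomial (Fin n) ℂ) := by
  have hc : coeff (Finsupp.single i 1) (X i - X j : MvPolynomial (Fin n) ℂ) = 1 := by
    have hne : Finsupp.single j 1 ≠ Finsupp.single i 1 := fun hh =>
      h ((Finsupp.single_left_injective one_ne_zero hh).symm)
    rw [coeff_sub, coeff_X, coeff_X, if_pos rfl, if_neg hne, sub_zero]
  refine irreducible_of_totalDegree_eq_one ?_ ?_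
  · apply le_antisymm
    · refine (totalDegree_sub _ _).trans ?_
      simp
    · have := le_totalDegree (p := (X i - X j : MvPolynomial (Fin n) ℂ))
        (s := Finsupp.single i 1) (by rw [mem_support_iff, hc]; exact one_ne_zero)
      simpa using this
  · intro x hx
    exact isUnit_of_dvd_one (hc ▸ hx (Finsupp.single i 1))

theorem X_sub_X_not_dvd {n : ℕ} {i j k l : Fin n} (hij : i < j) (hkl : k < l)
    (h : ¬ (i = k ∧ j = l)) :
    ¬ (X i - X j : MvPolynomial (Fin n) ℂ) ∣ X k - X l := by
  rintro ⟨p, hp⟩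
  have := congrArg (aeval (fun a : Fin n => (X (if a = i then j else a) :
    MvPolynomial (Fin n) ℂ))) hp
  simp only [map_sub, map_mul, aeval_X, if_true, if_neg hij.ne', sub_self, zero_mul] at this
  have h2 := X_injective (sub_eq_zero.mp this)
  grind

theorem alternant_delta_dvd {n : ℕ} (μ : Fin n → ℕ) : alternant (delta n) ∣ alternant μ := by
  rw [alternant_delta, vandermondeProd, Finset.prod_sigma']
  refine Finset.prod_dvd_of_isRelPrime ?_ ?_
  · rintro ⟨i, j⟩ hp ⟨k, l⟩ hq hne
    simp only [Finset.coe_sigma, Set.mem_sigma_iff, Finset.coe_univ, Set.mem_univ, true_and,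
      Finset.coe_Ioi, Set.mem_Ioi] at hp hq
    refine ((X_sub_X_irreducible hp.ne).isRelPrime_iff_not_dvd).2 (X_sub_X_not_dvd hp hq ?_)
    rintro ⟨rfl, rfl⟩
    exact hne rfl
  · rintro ⟨i, j⟩ hp
    simp only [Finset.mem_sigma, Finset.mem_univ, true_and, Finset.mem_Ioi] at hp
    exact X_sub_X_dvd_alternant μ hp.ne

theorem alternant_delta_ne_zero (n : ℕ) : alternant (delta n) ≠ 0 := by
  rw [alternant_delta, vandermondeProd]
  refine Finset.prod_ne_zero_iff.2 fun i _ => Finset.prod_ne_zero_iff.2 fun j hj => ?_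
  exact (X_sub_X_irreducible (Finset.mem_Ioi.1 hj).ne).ne_zero

/-- The Schur polynomial `s_λ = a_{λ+δ} / a_δ` (exact quotient in the polynomial ring). -/
noncomputable def schurPoly {n : ℕ} (l : Part n) : MvPolynomial (Fin n) ℂ :=
  Classical.choose (alternant_delta_dvd (shifted l))

theorem alternant_delta_mul_schurPoly {n : ℕ} (l : Part n) :
    alternant (delta n) * schurPoly l = alternant (shifted l) :=
  (Classical.choose_spec (alternant_delta_dvd (shifted l))).symm

theorem rename_alternant {n : ℕ} (μ : Fin n → ℕ) (σ : Equiv.Perm (Fin n)) :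
    rename σ (alternant μ) = ((Equiv.Perm.sign σ : ℤ) : MvPolynomial (Fin n) ℂ) * alternant μ := by
  rw [alternant, ← Matrix.det_permute, ← AlgHom.coe_toRingHom, RingHom.map_det]
  congr 1
  ext1 i j
  simp

theorem schurPoly_isSymmetric {n : ℕ} (l : Part n) : (schurPoly l).IsSymmetric := by
  intro σ
  have h := congrArg (rename σ) (alternant_delta_mul_schurPoly l)
  rw [map_mul, rename_alternant, rename_alternant, ← alternant_delta_mul_schurPoly, mul_assoc] at h
  have hs : ((Equiv.Perm.sign σ : ℤ) : MvPolynomial (Fin n) ℂ) ≠ 0 := by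
    rcases Int.units_eq_one_or (Equiv.Perm.sign σ) with h' | h' <;> simp [h']
  exact mul_left_cancel₀ (alternant_delta_ne_zero n) (mul_left_cancel₀ hs h)

/-- The Schur polynomial as an element of the algebra of symmetric polynomials. -/
noncomputable def schurSym {n : ℕ} (l : Part n) : Sym n :=
  ⟨schurPoly l, schurPoly_isSymmetric l⟩

theorem coeff_alternant {n : ℕ} {μ ν : Fin n → ℕ} (hμ : StrictAnti μ) (hν : StrictAnti ν) :
    coeff (Finsupp.equivFunOnFinite.symm ν) (alternant μ) = if μ = ν then 1 else 0 := by
  have hmon : ∀ σ : Equiv.Perm (Fin n), (∏ i, (X (σ i) : MvPolynomial (Fin n) ℂ) ^ μ i) =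
      monomial (Finsupp.equivFunOnFinite.symm (μ ∘ σ.symm)) 1 := by
    intro σ
    rw [monomial_eq, C_1, one_mul, Finsupp.prod_fintype _ _ (by simp)]
    refine Fintype.prod_equiv σ _ _ fun i => ?_
    simp
  have hperm : ∀ σ : Equiv.Perm (Fin n), μ ∘ σ.symm = ν → σ = 1 := by
    intro σ h
    have hs : StrictMono σ.symm := by
      intro a b hab
      have : ν b < ν a := hν hab
      rw [← h] at this
      exact hμ.lt_iff_gt.1 this
    have h1 : hs.orderIsoOfSurjective _ σ.symm.surjective = OrderIso.refl (Fin n) :=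
      Subsingleton.elim _ _
    ext1 i
    have h2 : σ.symm (σ i) = σ i := DFunLike.congr_fun h1 (σ i)
    rw [Equiv.symm_apply_apply] at h2
    exact h2.symm
  simp only [alternant, Matrix.det_apply, Matrix.of_apply, hmon, coeff_sum]
  rw [Finset.sum_eq_single 1]
  · simp only [Equiv.Perm.sign_one, one_smul, coeff_monomial,
      Finsupp.equivFunOnFinite.symm.injective.eq_iff]
    rfl
  · intro σ _ hσ
    rw [Units.smul_def, coeff_smul, coeff_monomial, if_neg, smul_zero]
    intro h
    exact hσ (hperm σ (Finsupp.equivFunOnFinite.symm.injective h))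
  · simp

theorem eq_zero_of_antisymmetric {n : ℕ} {g : MvPolynomial (Fin n) ℂ}
    (hg : ∀ σ : Equiv.Perm (Fin n),
      rename σ g = ((Equiv.Perm.sign σ : ℤ) : MvPolynomial (Fin n) ℂ) * g)
    (h0 : ∀ ν : Fin n → ℕ, StrictAnti ν → coeff (Finsupp.equivFunOnFinite.symm ν) g = 0) :
    g = 0 := by
  have key : ∀ (σ : Equiv.Perm (Fin n)) (m : Fin n → ℕ),
      coeff (Finsupp.equivFunOnFinite.symm (m ∘ σ)) g =
        ((Equiv.Perm.sign σ : ℤ) : ℂ) * coeff (Finsupp.equivFunOnFinite.symm m) g := by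
    intro σ m
    have h1 : Finsupp.mapDomain σ (Finsupp.equivFunOnFinite.symm (m ∘ σ)) =
        Finsupp.equivFunOnFinite.symm m := by
      ext i
      obtain ⟨k, rfl⟩ := σ.surjective i
      rw [Finsupp.mapDomain_apply σ.injective]
      simp
    have h2 := coeff_rename_mapDomain σ σ.injective g (Finsupp.equivFunOnFinite.symm (m ∘ σ))
    rw [h1, hg] at h2
    rw [← h2, show ((Equiv.Perm.sign σ : ℤ) : MvPolynomial (Fin n) ℂ) =
      C ((Equiv.Perm.sign σ : ℤ) : ℂ) by simp, coeff_C_mul]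
  ext m
  obtain ⟨m, rfl⟩ := Finsupp.equivFunOnFinite.symm.surjective m
  rw [coeff_zero]
  by_cases hm : Function.Injective m
  · let σ : Equiv.Perm (Fin n) := Tuple.sort (fun i => OrderDual.toDual (m i))
    have hmono : Monotone ((fun i => OrderDual.toDual (m i)) ∘ σ) := Tuple.monotone_sort _
    have hanti : Antitone (m ∘ σ) := fun a b hab => hmono hab
    have hk := key σ m
    rw [h0 _ (hanti.strictAnti_of_injective (hm.comp σ.injective))] at hk
    rcases Int.units_eq_one_or (Equiv.Perm.sign σ) with h' | h' <;> simpa [h'] using hk.symm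
  · simp only [Function.Injective, not_forall] at hm
    obtain ⟨a, b, hab, hne⟩ := hm
    have hk := key (Equiv.swap a b) m
    have : m ∘ Equiv.swap a b = m := by
      funext i
      simp only [Function.comp, Equiv.swap_apply_def]
      split_ifs <;> simp_all
    rw [this, Equiv.Perm.sign_swap hne] at hk
    push_cast at hk
    linear_combination hk / 2

theorem shifted_strictAnti {n : ℕ} (l : Part n) : StrictAnti (shifted l) := by
  intro a b hab
  have := l.2 hab.le
  have h2 : (a : ℕ) < b := hab
  simp only [shifted, delta]
  omega

theorem shifted_injective {n : ℕ} : Function.Injective (shifted (n := n)) := by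
  intro a b h
  ext i
  have := congrFun h i
  simpa [shifted] using this

theorem exists_shifted_eq {n : ℕ} {ν : Fin n → ℕ} (hν : StrictAnti ν) :
    ∃ l : Part n, shifted l = ν := by
  have hstep : ∀ d : ℕ, ∀ i j : Fin n, (j : ℕ) = i + d → ν j + d ≤ ν i := by
    intro d
    induction d with
    | zero => intro i j h; rw [show j = i from Fin.ext (by omega)]; simp
    | succ d ih =>
      intro i j h
      have h1 := ih i ⟨i + d, by omega⟩ rfl
      have h2 : ν j < ν ⟨i + d, by omega⟩ := hν (by rw [Fin.lt_def, h]; simp)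
      omega
  have hge : ∀ i : Fin n, delta n i ≤ ν i := by
    intro i
    have := hstep (n - 1 - i) i ⟨n - 1, by have := i.isLt; omega⟩ (by have := i.isLt; simp; omega)
    simp only [delta]
    omega
  refine ⟨⟨fun i => ν i - delta n i, ?_⟩, ?_⟩
  · intro a b hab
    have h1 : (a : ℕ) ≤ b := hab
    have h2 := hstep (b - a) a b (by omega)
    have := hge a
    have := hge b
    change ν b - delta n b ≤ ν a - delta n a
    simp only [delta] at *
    omega
  · funext i
    have := hge i
    simp only [shifted]
    omega

theorem schurSym_linearIndependent (n : ℕ) :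
    LinearIndependent ℂ (schurSym (n := n)) := by
  rw [linearIndependent_iff']
  intro s c hc k hk
  have h1 : ∑ l ∈ s, c l • alternant (shifted l) = 0 := by
    have := congrArg (fun f : Sym n => alternant (delta n) * (f : MvPolynomial (Fin n) ℂ)) hc
    simpa [Finset.mul_sum, schurSym, alternant_delta_mul_schurPoly] using this
  have h2 := congrArg (coeff (Finsupp.equivFunOnFinite.symm (shifted k))) h1
  simpa [coeff_sum, coeff_alternant (shifted_strictAnti _) (shifted_strictAnti _),
    shifted_injective.eq_iff, hk] using h2

theorem schurSym_span (n : ℕ) : ⊤ ≤ Submodule.span ℂ (Set.range (schurSym (n := n))) := by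
  intro f _
  set g : MvPolynomial (Fin n) ℂ := alternant (delta n) * (f : MvPolynomial (Fin n) ℂ) with hg
  let φ : Part n → (Fin n →₀ ℕ) := fun l => Finsupp.equivFunOnFinite.symm (shifted l)
  have hφ : Function.Injective φ :=
    Finsupp.equivFunOnFinite.symm.injective.comp shifted_injective
  let s : Finset (Part n) := g.support.preimage φ hφ.injOn
  have hz : g - ∑ l ∈ s, coeff (φ l) g • alternant (shifted l) = 0 := by
    refine eq_zero_of_antisymmetric ?_ ?_
    · intro σ
      have hfs : rename σ (f : MvPolynomial (Fin n) ℂ) = f := f.2 σ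
      simp only [map_sub, map_sum, hg, map_mul, rename_alternant, hfs, map_smul, mul_sub,
        Finset.mul_sum, mul_smul_comm, mul_assoc]
    · intro ν hν
      obtain ⟨k, rfl⟩ := exists_shifted_eq hν
      simp only [coeff_sub, coeff_sum, coeff_smul, shifted_injective.eq_iff,
        coeff_alternant (shifted_strictAnti _) (shifted_strictAnti _)]
      simp only [smul_eq_mul, mul_ite, mul_one, mul_zero, Finset.sum_ite_eq']
      split_ifs with hk
      · simp [φ]
      · have : coeff (φ k) g = 0 := by simpa [s] using hk
        simpa [φ] using this
  have hf : f = ∑ l ∈ s, coeff (φ l) g • schurSym l := by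
    apply Subtype.ext
    apply mul_left_cancel₀ (alternant_delta_ne_zero n)
    rw [← hg]
    refine (sub_eq_zero.1 hz).trans ?_
    simp [Finset.mul_sum, schurSym, alternant_delta_mul_schurPoly]
  rw [hf]
  exact Submodule.sum_mem _ fun l _ =>
    Submodule.smul_mem _ _ (Submodule.subset_span (Set.mem_range_self l))

/-- The Schur polynomials form a basis of the space of symmetric polynomials. -/
noncomputable def schurBasis (n : ℕ) : Module.Basis (Part n) ℂ (Sym n) :=
  Module.Basis.mk (schurSym_linearIndependent n) (schurSym_span n)

/-- The normalized Schur polynomial `s̄_λ = s_λ / s_λ(1, …, 1)`. -/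
noncomputable def schurBar {n : ℕ} (l : Part n) : Sym n :=
  (eval (fun _ => (1 : ℂ)) (schurPoly l))⁻¹ • schurSym l

/-- The polynomial `q_λ(z) = s̄_λ(z, 1, …, 1)`. -/
noncomputable def qPoly {n : ℕ} (l : Part n) : Polynomial ℂ :=
  aeval (fun i : Fin n => if (i : ℕ) = 0 then (Polynomial.X : Polynomial ℂ) else 1)
    (schurBar l : MvPolynomial (Fin n) ℂ)

/-- The `Q`-operator at the point `z`: the linear operator on symmetric polynomials which is
diagonal in the Schur basis with eigenvalues `q_λ(z)`. -/
noncomputable def Qop (n : ℕ) (z : ℂ) : Sym n →ₗ[ℂ] Sym n :=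
  (schurBasis n).constr ℂ fun l => (qPoly l).eval z • schurSym l

/-- The normalized Schur polynomials are eigenvectors of `Q_z` with eigenvalues `q_λ(z)`. -/
theorem Qop_schurBar {n : ℕ} (z : ℂ) (l : Part n) :
    Qop n z (schurBar l) = (qPoly l).eval z • schurBar l := by
  have h : Qop n z (schurSym l) = (qPoly l).eval z • schurSym l := by
    have := (schurBasis n).constr_basis ℂ (fun l => (qPoly l).eval z • schurSym l) l
    simpa [schurBasis, Qop] using this
  rw [schurBar, map_smul, h, smul_comm]

/-- The interlacing domain `y_1 < x_1 < y_2 < x_2 < … < x_{n-1} < y_n < x_n`. -/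
def interlacing {n : ℕ} (y : Fin n → ℝ) : Set (Fin n → ℝ) :=
  {x | (∀ i, y i < x i) ∧ ∀ i j : Fin n, (i : ℕ) + 1 = j → x i < y j}

/-- `∫_Ω δ(g(x)) F(x) dx = I`, where `δ` is the Dirac delta function on the line: for every
continuous compactly supported `φ` of total mass `1`, the integrals in which `δ` is replaced by its
approximation `t ↦ ε⁻¹ φ(t/ε)` exist for all small `ε > 0` and converge to `I` as `ε → 0⁺`. -/
def HasDeltaIntegral {n : ℕ} (Ω : Set (Fin n → ℝ)) (g : (Fin n → ℝ) → ℝ)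
    (F : (Fin n → ℝ) → ℂ) (I : ℂ) : Prop :=
  ∀ φ : ℝ → ℝ, Continuous φ → HasCompactSupport φ → ∫ t, φ t = 1 →
    (∀ᶠ ε in 𝓝[>] (0 : ℝ), IntegrableOn (fun x => ((ε⁻¹ * φ (g x / ε) : ℝ) : ℂ) * F x) Ω) ∧
    Tendsto (fun ε : ℝ => ∫ x in Ω, ((ε⁻¹ * φ (g x / ε) : ℝ) : ℂ) * F x) (𝓝[>] 0) (𝓝 I)

/-- The value of a delta-function integral is unique. -/
theorem HasDeltaIntegral.unique {n : ℕ} {Ω : Set (Fin n → ℝ)} {g : (Fin n → ℝ) → ℝ}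
    {F : (Fin n → ℝ) → ℂ} {I J : ℂ} (hI : HasDeltaIntegral Ω g F I)
    (hJ : HasDeltaIntegral Ω g F J) : I = J := by
  let b : ContDiffBump (0 : ℝ) := default
  exact tendsto_nhds_unique
    (hI (b.normed volume) b.continuous_normed b.hasCompactSupport_normed b.integral_normed).2
    (hJ (b.normed volume) b.continuous_normed b.hasCompactSupport_normed b.integral_normed).2

end SchurQ

/-! Put m = n - 1, μ = λ + δ, Y = ∏ y_i. Both sides are linear in f and Schur polynomials span, so f
= s_λ suffices; then Δ_n(x) f(x) is the alternant a_μ(x) = det(x_i^{μ_j}). The function linking the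
two sides is the divided difference D(w) = ∑_j w^{μ_j} / ∏_{k≠j} (μ_j - μ_k), which is `dividedPow`.

Algebraic side: q_λ(w) (w-1)^m = m! D(w) (`qPoly_eval_mul`). The quotient of alternants is 0/0 at
(w,1,…,1), so it is computed at (w,1,q,…,q^{m-1}) and q → 1⁺. There the alternant, expanded along
the row of w, is a multiple of a divided difference with nodes q^{μ_j} (`det_cons_pow`).

Analytic side: the image of a_μ(x) dx on Ω under w = ∏ x_i / Y has density Y a_μ(y) D(w) on w > 1
(`integral_comp_prod_mul_det`). This is checked on negative moments. Ω is a product of intervals, so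
∫ (∏ x_i)^{-s} a_μ is a determinant of one-dimensional integrals. Its rows are differences of
consecutive tail integrals and telescope, leaving a_μ(y) Y^{1-s} ∏_j (s-1-μ_j)⁻¹; by partial
fractions, that product is the moment of D. In the variable 1/w ∈ [0,1], Weierstrass approximation
passes from moments to continuous test functions.

An approximate delta at w = z now picks out D(z), and the two sides match. -/

namespace SchurQ

/-! ### Divided differences and Schur polynomials at (w, 1, …, 1) -/

/-- The divided difference `∑_j w ^ μ_j / ∏_{k ≠ j} (μ_j - μ_k)` of the function `t ↦ w ^ t`. -/
noncomputable def dividedPow {K : Type*} [Field K] {n : ℕ} (μ : Fin n → ℕ) (w : K) : K :=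
  ∑ j, Lagrange.nodalWeight Finset.univ (fun i => (μ i : K)) j * w ^ μ j

/-- The sum is the coefficient of t^m in the Lagrange interpolant of t^i through the m + 1 nodes,
and that interpolant is t^i itself. -/
theorem sum_nodalWeight_mul_pow {K : Type*} [Field K] {m : ℕ} {v : Fin (m + 1) → K}
    (hv : Function.Injective v) (i : Fin (m + 1)) :
    ∑ j, Lagrange.nodalWeight Finset.univ v j * v j ^ (i : ℕ) =
      if i = Fin.last m then 1 else 0 := by
  have hd : (Polynomial.X ^ (i : ℕ) : Polynomial K).degree <
      (Finset.univ : Finset (Fin (m + 1))).card := by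
    rw [Polynomial.degree_X_pow, Finset.card_univ, Fintype.card_fin]
    exact_mod_cast i.isLt
  have h := Lagrange.coeff_eq_sum (s := Finset.univ) hv.injOn hd
  rw [Polynomial.coeff_X_pow, Finset.card_univ, Fintype.card_fin] at h
  have h2 : (m + 1 - 1 = (i : ℕ)) ↔ i = Fin.last m := by
    rw [Fin.ext_iff, Fin.val_last]; omega
  simp only [h2] at h
  rw [h]
  refine Finset.sum_congr rfl fun j _ => ?_
  rw [Lagrange.nodalWeight, Finset.prod_inv_distrib, Polynomial.eval_pow, Polynomial.eval_X,
    div_eq_inv_mul]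

/-- Both sides are linear functionals of the first row u. For u = v^i with i < m both vanish, the
determinant by a repeated row; for u = v^m they agree. Since the nodes are distinct, these powers
form an invertible Vandermonde matrix, so the functionals coincide. -/
theorem det_cons_pow {K : Type*} [Field K] {m : ℕ} {v : Fin (m + 1) → K}
    (hv : Function.Injective v) (u : Fin (m + 1) → K) :
    (Matrix.of (Fin.cons u fun (i : Fin m) j => v j ^ (i : ℕ) :
      Fin (m + 1) → Fin (m + 1) → K)).det =
    (∑ j, Lagrange.nodalWeight Finset.univ v j * u j) *
      (Matrix.of (Fin.cons (fun j => v j ^ m) fun (i : Fin m) j => v j ^ (i : ℕ) :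
        Fin (m + 1) → Fin (m + 1) → K)).det := by
  let D : (Fin (m + 1) → K) → K := fun u =>
    (Matrix.of (Fin.cons u fun (i : Fin m) j => v j ^ (i : ℕ) :
      Fin (m + 1) → Fin (m + 1) → K)).det
  let c : Fin (m + 1) → K := fun j => (-1) ^ (j : ℕ) *
    (Matrix.of fun (i k : Fin m) => v (j.succAbove k) ^ (i : ℕ)).det
  have hD : ∀ u, D u = ∑ j, c j * u j := by
    intro u
    simp only [D]
    rw [Matrix.det_succ_row_zero]
    refine Finset.sum_congr rfl fun j _ => ?_
    have : (Matrix.of (Fin.cons u fun (i : Fin m) j => v j ^ (i : ℕ) :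
        Fin (m + 1) → Fin (m + 1) → K)).submatrix Fin.succ j.succAbove =
        Matrix.of fun (i k : Fin m) => v (j.succAbove k) ^ (i : ℕ) := by
      ext i k; simp
    rw [this]
    simp only [c, Matrix.of_apply, Fin.cons_zero]
    ring
  have hDv : ∀ i : Fin (m + 1), D (fun j => v j ^ (i : ℕ)) =
      if i = Fin.last m then D (fun j => v j ^ m) else 0 := by
    intro i
    split_ifs with hi
    · rw [hi, Fin.val_last]
    · have him : (i : ℕ) < m := Fin.val_lt_last hi
      refine Matrix.det_zero_of_row_eq (i := 0) (j := Fin.succ ⟨i, him⟩)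
        (Fin.succ_ne_zero _).symm ?_
      funext j
      rw [Matrix.of_apply, Matrix.of_apply, Fin.cons_succ, Fin.cons_zero]
  have hz := Matrix.eq_zero_of_forall_pow_sum_mul_pow_eq_zero (f := v)
    (v := fun j => c j - Lagrange.nodalWeight Finset.univ v j * D fun j => v j ^ m) hv (by
      intro i
      have h1 := sum_nodalWeight_mul_pow hv i
      have h2 := hDv i
      rw [hD] at h2
      simp only [sub_mul, Finset.sum_sub_distrib, h2, mul_right_comm _ (D _), ← Finset.sum_mul, h1]
      split_ifs <;> simp)
  change D u = _ * D _
  rw [hD u, Finset.sum_mul]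
  refine Finset.sum_congr rfl fun j _ => ?_
  have := congrFun hz j
  simp only [Pi.zero_apply, sub_eq_zero] at this
  rw [this]; ring

theorem eval_alternant {n : ℕ} (μ : Fin n → ℕ) (x : Fin n → ℂ) :
    eval x (alternant μ) = (Matrix.of fun i j => x i ^ μ j).det := by
  rw [alternant, RingHom.map_det]
  congr 1
  ext i j
  simp

theorem eval_alternant_delta {n : ℕ} (x : Fin n → ℂ) :
    eval x (alternant (delta n)) = vandermondeProd x := by
  rw [alternant_delta]
  simp [vandermondeProd]

theorem vandermondeProd_cons {R : Type*} [CommRing R] {m : ℕ} (w : R) (x : Fin m → R) :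
    vandermondeProd (Fin.cons w x : Fin (m + 1) → R) = (∏ i, (w - x i)) * vandermondeProd x := by
  simp only [vandermondeProd, Fin.prod_univ_succ, Fin.prod_Ioi_zero, Fin.prod_Ioi_succ,
    Fin.cons_zero, Fin.cons_succ]

theorem vandermondeProd_ne_zero {R : Type*} [CommRing R] [IsDomain R] {n : ℕ} {x : Fin n → R}
    (hx : Function.Injective x) : vandermondeProd x ≠ 0 :=
  Finset.prod_ne_zero_iff.2 fun _ _ => Finset.prod_ne_zero_iff.2 fun _ hj =>
    sub_ne_zero.2 fun h => (Finset.mem_Ioi.1 hj).ne (hx h)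

theorem vandermondeProd_mul_eval_schurPoly {n : ℕ} (l : Part n) (x : Fin n → ℂ) :
    vandermondeProd x * eval x (schurPoly l) = (Matrix.of fun i j => x i ^ shifted l j).det := by
  rw [← eval_alternant_delta, ← map_mul, alternant_delta_mul_schurPoly, eval_alternant]

theorem injective_pow_of_one_lt {ι : Type*} {q : ℝ} (hq : 1 < q) {f : ι → ℕ}
    (hf : Function.Injective f) : Function.Injective fun i => (q : ℂ) ^ f i := by
  intro a b hab
  have h : q ^ f a = q ^ f b := by exact_mod_cast (show (q : ℂ) ^ f a = (q : ℂ) ^ f b from hab)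
  exact hf (pow_right_injective₀ (by linarith) hq.ne' h)

/-- Evaluation of a Schur polynomial at `(w, 1, q, q², …)`. -/
theorem eval_schurPoly_cons_geometric {m : ℕ} (l : Part (m + 1)) {q : ℝ} (hq : 1 < q) (w : ℂ) :
    eval (Fin.cons w fun i : Fin m => (q : ℂ) ^ (i : ℕ)) (schurPoly l) *
        ∏ i : Fin m, (w - (q : ℂ) ^ (i : ℕ)) =
      eval (Fin.cons ((q : ℂ) ^ m) fun i : Fin m => (q : ℂ) ^ (i : ℕ)) (schurPoly l) *
        (∏ i : Fin m, ((q : ℂ) ^ m - (q : ℂ) ^ (i : ℕ))) *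
        ∑ j, Lagrange.nodalWeight Finset.univ (fun j => (q : ℂ) ^ shifted l j) j *
          w ^ shifted l j := by
  have hV : vandermondeProd (fun i : Fin m => (q : ℂ) ^ (i : ℕ)) ≠ 0 :=
    vandermondeProd_ne_zero (injective_pow_of_one_lt hq Fin.val_injective)
  have hrow : ∀ w : ℂ,
      (Matrix.of fun i j => (Fin.cons w fun i : Fin m => (q : ℂ) ^ (i : ℕ) : Fin (m + 1) → ℂ) i ^
        shifted l j).det =
      (Matrix.of (Fin.cons (fun j => w ^ shifted l j)
        fun (i : Fin m) j => ((q : ℂ) ^ shifted l j) ^ (i : ℕ) :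
          Fin (m + 1) → Fin (m + 1) → ℂ)).det := by
    intro w
    congr 1
    ext i j
    refine Fin.cases ?_ (fun i => ?_) i
    · simp
    · simp [← pow_mul, mul_comm]
  have hpow : (fun j => ((q : ℂ) ^ m) ^ shifted l j) = fun j => ((q : ℂ) ^ shifted l j) ^ m := by
    funext j; rw [← pow_mul, ← pow_mul, mul_comm]
  -- The reference determinant, with first row (q^{μ_j})^m, is the same alternant at w = q^m. The
  -- common factor Δ_m(1, q, …, q^{m-1}) then cancels.
  have h := det_cons_pow
    (injective_pow_of_one_lt hq (shifted_strictAnti l).injective) fun j => w ^ shifted l j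
  rw [← hrow, ← hpow, ← hrow, ← vandermondeProd_mul_eval_schurPoly,
    ← vandermondeProd_mul_eval_schurPoly, vandermondeProd_cons, vandermondeProd_cons] at h
  apply mul_left_cancel₀ hV
  linear_combination h

theorem tendsto_pow_sub_pow_div (a b : ℕ) :
    Tendsto (fun q : ℝ => ((q : ℂ) ^ a - (q : ℂ) ^ b) / ((q : ℂ) - 1)) (𝓝[>] 1)
      (𝓝 ((a : ℂ) - b)) := by
  have h : ∀ c : ℕ, Tendsto (fun q : ℝ => ∑ i ∈ Finset.range c, (q : ℂ) ^ i) (𝓝[>] 1)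
      (𝓝 (c : ℂ)) := by
    intro c
    have : Continuous fun q : ℝ => ∑ i ∈ Finset.range c, (q : ℂ) ^ i := by fun_prop
    simpa using (this.tendsto 1).mono_left nhdsWithin_le_nhds
  refine ((h a).sub (h b)).congr' ?_
  filter_upwards [self_mem_nhdsWithin] with q hq
  have hq1 : (q : ℂ) ≠ 1 := by exact_mod_cast (ne_of_gt hq)
  rw [geom_sum_eq hq1, geom_sum_eq hq1]
  ring

theorem tendsto_eval {n : ℕ} (p : MvPolynomial (Fin n) ℂ) {x : ℝ → Fin n → ℂ} {a : Fin n → ℂ}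
    {F : Filter ℝ} (hx : Tendsto x F (𝓝 a)) : Tendsto (fun q => eval (x q) p) F (𝓝 (eval a p)) :=
  ((MvPolynomial.continuous_eval p).tendsto a).comp hx

theorem tendsto_pow_one (k : ℕ) : Tendsto (fun q : ℝ => (q : ℂ) ^ k) (𝓝[>] 1) (𝓝 1) := by
  have : Continuous fun q : ℝ => (q : ℂ) ^ k := by fun_prop
  simpa using (this.tendsto 1).mono_left nhdsWithin_le_nhds

theorem tendsto_cons_geometric {m : ℕ} {w : ℝ → ℂ} {a : ℂ} (hw : Tendsto w (𝓝[>] 1) (𝓝 a)) :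
    Tendsto (fun q : ℝ => (Fin.cons (w q) fun i : Fin m => (q : ℂ) ^ (i : ℕ) : Fin (m + 1) → ℂ))
      (𝓝[>] 1) (𝓝 (Fin.cons a fun _ => 1)) := by
  rw [tendsto_pi_nhds]
  refine Fin.cases ?_ fun i => ?_
  · simpa using hw
  · simpa using tendsto_pow_one i

theorem prod_fin_sub_eq_factorial (m : ℕ) : ∏ i : Fin m, ((m : ℂ) - (i : ℕ)) = m.factorial := by
  rw [Fin.prod_univ_eq_prod_range (fun i => (m : ℂ) - i) m, ← Finset.prod_range_add_one_eq_factorial,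
    ← Finset.prod_range_reflect, Nat.cast_prod]
  refine Finset.prod_congr rfl fun i hi => ?_
  have := Finset.mem_range.1 hi
  rw [show m - 1 - i = m - (i + 1) by omega, Nat.cast_sub (by omega)]
  push_cast; ring

/-- Evaluation of a Schur polynomial at `(w, 1, …, 1)`. -/
theorem eval_schurPoly_cons_one {m : ℕ} (l : Part (m + 1)) (w : ℂ) :
    eval (Fin.cons w fun _ => 1) (schurPoly l) * (w - 1) ^ m =
      eval (fun _ => 1) (schurPoly l) * m.factorial * dividedPow (shifted l) w := by
  have hone : (Fin.cons 1 fun _ => 1 : Fin (m + 1) → ℂ) = fun _ => 1 := by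
    funext i; refine Fin.cases ?_ (fun i => ?_) i <;> simp
  have hL : Tendsto (fun q : ℝ =>
      eval (Fin.cons w fun i : Fin m => (q : ℂ) ^ (i : ℕ)) (schurPoly l) *
        ∏ i : Fin m, (w - (q : ℂ) ^ (i : ℕ))) (𝓝[>] 1)
      (𝓝 (eval (Fin.cons w fun _ => 1) (schurPoly l) * (w - 1) ^ m)) := by
    refine (tendsto_eval _ (tendsto_cons_geometric tendsto_const_nhds)).mul ?_
    have := tendsto_finsetProd (Finset.univ : Finset (Fin m)) fun i _ =>
      (tendsto_const_nhds (x := w)).sub (tendsto_pow_one i)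
    simpa using this
  have hinj : Function.Injective fun j => (shifted l j : ℂ) :=
    Nat.cast_injective.comp (shifted_strictAnti l).injective
  -- Each difference is divided by q - 1: the m factors so introduced in the product cancel the m
  -- factors in each nodal weight. In the limit the product becomes ∏ (m - i) = m!, and the
  -- reference point (q^m, 1, …, q^{m-1}) becomes (1, …, 1).
  have hR : Tendsto (fun q : ℝ =>
      eval (Fin.cons ((q : ℂ) ^ m) fun i : Fin m => (q : ℂ) ^ (i : ℕ)) (schurPoly l) *
        (∏ i : Fin m, (((q : ℂ) ^ m - (q : ℂ) ^ (i : ℕ)) / ((q : ℂ) - 1))) *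
        ∑ j, (∏ k ∈ Finset.univ.erase j,
          (((q : ℂ) ^ shifted l j - (q : ℂ) ^ shifted l k) / ((q : ℂ) - 1))⁻¹) * w ^ shifted l j)
      (𝓝[>] 1)
      (𝓝 (eval (fun _ => 1) (schurPoly l) * m.factorial * dividedPow (shifted l) w)) := by
    rw [← hone, ← prod_fin_sub_eq_factorial]
    refine ((tendsto_eval (schurPoly l) (tendsto_cons_geometric (tendsto_pow_one m))).mul ?_).mul ?_
    · exact tendsto_finsetProd _ fun (i : Fin m) _ => tendsto_pow_sub_pow_div m i
    refine tendsto_finsetSum _ fun j _ => Tendsto.mul_const _ ?_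
    refine tendsto_finsetProd _ fun k hk => (tendsto_pow_sub_pow_div _ _).inv₀ ?_
    exact sub_ne_zero.2 fun h => (Finset.ne_of_mem_erase hk) (hinj h).symm
  refine tendsto_nhds_unique hL (hR.congr' ?_)
  filter_upwards [self_mem_nhdsWithin] with q hq
  have hq1 : (q : ℂ) - 1 ≠ 0 := sub_ne_zero.2 (by exact_mod_cast (ne_of_gt hq))
  rw [eval_schurPoly_cons_geometric l hq, mul_assoc, mul_assoc]
  congr 1
  rw [Finset.prod_div_distrib, Finset.prod_const, Finset.card_univ, Fintype.card_fin,
    Finset.mul_sum, Finset.mul_sum]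
  refine Finset.sum_congr rfl fun j _ => ?_
  have hw : ∏ k ∈ Finset.univ.erase j,
      (((q : ℂ) ^ shifted l j - (q : ℂ) ^ shifted l k) / ((q : ℂ) - 1))⁻¹ =
      ((q : ℂ) - 1) ^ m * Lagrange.nodalWeight Finset.univ (fun j => (q : ℂ) ^ shifted l j) j := by
    rw [Lagrange.nodalWeight, Finset.prod_inv_distrib, Finset.prod_inv_distrib,
      Finset.prod_div_distrib, Finset.prod_const, Finset.card_erase_of_mem (Finset.mem_univ j),
      Finset.card_univ, Fintype.card_fin, Nat.add_sub_cancel, inv_div, div_eq_mul_inv]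
  rw [hw]
  field_simp

/-- At (1, q, q², …) both alternants are Vandermonde determinants. Dividing every factor by q - 1
and letting q → 1⁺ gives the Weyl dimension formula, Δ_n(0, …, n-1) s_λ(1, …, 1) = ∏_{i<j} (μ_j -
μ_i), whose right side is nonzero because the μ_j are distinct. -/
theorem eval_one_schurPoly_ne_zero {n : ℕ} (l : Part n) :
    eval (fun _ => (1 : ℂ)) (schurPoly l) ≠ 0 := by
  let W : (Fin n → ℂ) → ℂ := fun v => ∏ i, ∏ j ∈ Finset.Ioi i, (v j - v i)
  have hlim : ∀ f : Fin n → ℕ, Tendsto (fun q : ℝ => ∏ i, ∏ j ∈ Finset.Ioi i,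
      (((q : ℂ) ^ f j - (q : ℂ) ^ f i) / ((q : ℂ) - 1))) (𝓝[>] 1) (𝓝 (W fun i => (f i : ℂ))) :=
    fun f => tendsto_finsetProd _ fun i _ => tendsto_finsetProd _ fun j _ =>
      tendsto_pow_sub_pow_div _ _
  have hlim' : Tendsto (fun q : ℝ => ∏ i : Fin n, ∏ j ∈ Finset.Ioi i,
      (((q : ℂ) ^ (i : ℕ) - (q : ℂ) ^ (j : ℕ)) / ((q : ℂ) - 1))) (𝓝[>] 1)
      (𝓝 (vandermondeProd fun i : Fin n => ((i : ℕ) : ℂ))) :=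
    tendsto_finsetProd _ fun i _ => tendsto_finsetProd _ fun j _ => tendsto_pow_sub_pow_div _ _
  have hx : Tendsto (fun (q : ℝ) (i : Fin n) => (q : ℂ) ^ (i : ℕ)) (𝓝[>] 1) (𝓝 fun _ => 1) :=
    tendsto_pi_nhds.2 fun i => tendsto_pow_one i
  have hq : ∀ q : ℝ, vandermondeProd (fun i : Fin n => (q : ℂ) ^ (i : ℕ)) *
      eval (fun i : Fin n => (q : ℂ) ^ (i : ℕ)) (schurPoly l) =
        W fun i => (q : ℂ) ^ shifted l i := by
    intro q
    rw [vandermondeProd_mul_eval_schurPoly, ← Matrix.det_transpose]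
    refine Eq.trans ?_ (Matrix.det_vandermonde _)
    congr 1
    ext i j
    simp [Matrix.vandermonde_apply, ← pow_mul, mul_comm]
  have h := tendsto_nhds_unique (hlim (shifted l))
    ((hlim'.mul (tendsto_eval (schurPoly l) hx)).congr fun q => by
      simp only [Finset.prod_div_distrib]
      rw [div_mul_eq_mul_div]
      exact congrArg (· / _) (hq q))
  intro h0
  rw [h0, mul_zero] at h
  have hinj : Function.Injective fun j => (shifted l j : ℂ) :=
    Nat.cast_injective.comp (shifted_strictAnti l).injective
  revert h
  refine Finset.prod_ne_zero_iff.2 fun _ _ => Finset.prod_ne_zero_iff.2 fun _ hj =>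
    sub_ne_zero.2 fun h => (Finset.mem_Ioi.1 hj).ne' (hinj h)

theorem qPoly_eval_mul {m : ℕ} (l : Part (m + 1)) (w : ℂ) :
    (qPoly l).eval w * (w - 1) ^ m = m.factorial * dividedPow (shifted l) w := by
  have h : (qPoly l).eval w = (eval (fun _ => (1 : ℂ)) (schurPoly l))⁻¹ *
      eval (Fin.cons w fun _ => 1) (schurPoly l) := by
    have h2 : (Polynomial.evalRingHom w).comp (aeval (fun i : Fin (m + 1) =>
        if (i : ℕ) = 0 then (Polynomial.X : Polynomial ℂ) else 1)).toRingHom =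
        eval (Fin.cons w fun _ => 1) := by
      apply MvPolynomial.ringHom_ext
      · intro r; simp
      · refine Fin.cases ?_ fun i => ?_ <;> simp
    rw [← h2]
    simp [qPoly, schurBar, schurSym]
  rw [h, mul_assoc, eval_schurPoly_cons_one]
  field_simp [eval_one_schurPoly_ne_zero l]

/-! ### Negative moments of powers and of the divided difference -/

section Moments

variable {a : ℝ} {k s : ℕ}

theorem pow_mul_inv_pow_eq_rpow {x : ℝ} (hx : 0 < x) (k s : ℕ) :
    x ^ k * x⁻¹ ^ s = x ^ ((k : ℝ) - s) := by
  rw [Real.rpow_sub hx, Real.rpow_natCast, Real.rpow_natCast, inv_pow, div_eq_mul_inv]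

theorem integrableOn_pow_mul_inv_pow (ha : 0 < a) (hs : k + 1 < s) :
    IntegrableOn (fun x : ℝ => x ^ k * x⁻¹ ^ s) (Set.Ioi a) := by
  have hs' : (k : ℝ) + 1 < s := by exact_mod_cast hs
  refine (integrableOn_Ioi_rpow_of_lt (a := (k : ℝ) - s) (by linarith) ha).congr_fun
    (fun x hx => (pow_mul_inv_pow_eq_rpow (ha.trans hx) k s).symm) measurableSet_Ioi

theorem integral_pow_mul_inv_pow (ha : 0 < a) (hs : k + 1 < s) :
    ∫ x in Set.Ioi a, x ^ k * x⁻¹ ^ s = a * a⁻¹ ^ s * a ^ k * ((s : ℝ) - 1 - k)⁻¹ := by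
  have hs' : (k : ℝ) + 1 < s := by exact_mod_cast hs
  rw [setIntegral_congr_fun measurableSet_Ioi
    (fun x (hx : a < x) => pow_mul_inv_pow_eq_rpow (ha.trans hx) k s),
    integral_Ioi_rpow_of_lt (by linarith) ha, Real.rpow_add_one ha.ne',
    ← pow_mul_inv_pow_eq_rpow ha, show (s : ℝ) - 1 - k = -(k - s + 1) by ring, inv_neg, neg_div,
    div_eq_mul_inv]
  ring

end Moments

section DividedPow

variable {m : ℕ} {μ : Fin (m + 1) → ℕ} {s : ℕ}

theorem integrableOn_inv_pow_mul_dividedPow (hs : ∀ j, μ j + 1 < s) :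
    IntegrableOn (fun w : ℝ => w⁻¹ ^ s * dividedPow μ w) (Set.Ioi 1) := by
  simp only [dividedPow, Finset.mul_sum]
  refine integrable_finsetSum _ fun j _ => ?_
  refine ((integrableOn_pow_mul_inv_pow one_pos (hs j)).const_mul
    (Lagrange.nodalWeight Finset.univ (fun i => (μ i : ℝ)) j)).congr (ae_of_all _ fun w => ?_)
  simp only
  ring

/-- Termwise integration gives ∑_j (s-1-μ_j)⁻¹ / ∏_{k≠j} (μ_j - μ_k), the partial fraction expansion
of the product. The expansion is read off from Lagrange interpolation of the constant 1, evaluated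
at s - 1, which exceeds every node. -/
theorem integral_inv_pow_mul_dividedPow (hμ : Function.Injective μ) (hs : ∀ j, μ j + 1 < s) :
    ∫ w in Set.Ioi (1 : ℝ), w⁻¹ ^ s * dividedPow μ w = ∏ j, ((s : ℝ) - 1 - μ j)⁻¹ := by
  have h1 : ∀ w : ℝ, w⁻¹ ^ s * dividedPow μ w = ∑ j,
      Lagrange.nodalWeight Finset.univ (fun i => (μ i : ℝ)) j * (w ^ μ j * w⁻¹ ^ s) := by
    intro w
    rw [dividedPow, Finset.mul_sum]
    exact Finset.sum_congr rfl fun j _ => by ring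
  simp only [h1]
  rw [integral_finsetSum _ fun j _ =>
    (integrableOn_pow_mul_inv_pow one_pos (hs j)).integrable.const_mul _]
  have hne : ∀ j ∈ Finset.univ, (s : ℝ) - 1 ≠ μ j := by
    intro j _ h
    have h2 : (μ j : ℝ) + 1 < s := by exact_mod_cast hs j
    linarith
  have hinj : Function.Injective fun i => (μ i : ℝ) := Nat.cast_injective.comp hμ
  have h2 := Lagrange.eval_interpolate_not_at_node (s := Finset.univ)
    (v := fun i => (μ i : ℝ)) 1 hne
  rw [Lagrange.interpolate_one hinj.injOn Finset.univ_nonempty, Polynomial.eval_one,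
    Lagrange.eval_nodal] at h2
  rw [Finset.prod_inv_distrib, ← eq_inv_of_mul_eq_one_right h2.symm]
  refine Finset.sum_congr rfl fun j _ => ?_
  rw [integral_const_mul, integral_pow_mul_inv_pow one_pos (hs j)]
  simp

theorem continuous_dividedPow : Continuous (dividedPow μ : ℝ → ℝ) := by
  unfold dividedPow
  fun_prop

end DividedPow

/-! ### Determinants on product domains and moments over the interlacing domain -/

section ProductMeasure

variable {n : ℕ} {ν : Fin n → Measure ℝ} [∀ i, SigmaFinite (ν i)] {G : Fin n → ℝ → ℝ}

theorem integrable_det_pi (hG : ∀ i j, Integrable (G j) (ν i)) :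
    Integrable (fun x : Fin n → ℝ => (Matrix.of fun i j => G j (x i)).det) (Measure.pi ν) := by
  simp only [← Matrix.det_transpose (Matrix.of _), Matrix.det_apply', Matrix.transpose_apply,
    Matrix.of_apply]
  refine integrable_finsetSum _ fun σ _ => Integrable.const_mul ?_ _
  exact Integrable.fintype_prod (f := fun i => G (σ i)) fun i => hG i (σ i)

/-- Integration of a determinant against a product measure, row by row. -/
theorem integral_det_pi (hG : ∀ i j, Integrable (G j) (ν i)) :
    ∫ x : Fin n → ℝ, (Matrix.of fun i j => G j (x i)).det ∂Measure.pi ν =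
      (Matrix.of fun i j => ∫ t, G j t ∂ν i).det := by
  simp only [← Matrix.det_transpose (Matrix.of _), Matrix.det_apply', Matrix.transpose_apply,
    Matrix.of_apply]
  rw [integral_finsetSum _ fun σ _ => Integrable.const_mul
    (Integrable.fintype_prod (f := fun i => G (σ i)) fun i => hG i (σ i)) _]
  refine Finset.sum_congr rfl fun σ _ => ?_
  rw [integral_const_mul, integral_fintype_prod_eq_prod (fun i => G (σ i))]

end ProductMeasure

/-- Subtracting from each row the next one does not change the determinant. -/
theorem det_sub_next_row {R : Type*} [CommRing R] {m : ℕ}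
    {A B : Matrix (Fin (m + 1)) (Fin (m + 1)) R} (hlast : ∀ j, B (Fin.last m) j = A (Fin.last m) j)
    (hsucc : ∀ (i : Fin m) j, B i.castSucc j = A i.castSucc j - A i.succ j) : B.det = A.det := by
  -- Reversing the row order turns "subtract the next row" into the "add the previous row" form of
  -- the determinant lemma.
  rw [← Matrix.det_submatrix_equiv_self Fin.revPerm A,
    ← Matrix.det_submatrix_equiv_self Fin.revPerm B]
  symm
  refine Matrix.det_eq_of_forall_row_eq_smul_add_pred (fun _ => 1) (fun j => ?_) fun i j => ?_
  · simp [hlast]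
  · simp [Fin.rev_succ, Fin.rev_castSucc, hsucc]

section Interlacing

variable {m : ℕ} {y : Fin (m + 1) → ℝ}

/-- The interval swept out by the `i`-th coordinate of the interlacing domain. -/
def gap (y : Fin (m + 1) → ℝ) : Fin (m + 1) → Set ℝ :=
  Fin.lastCases (Set.Ioi (y (Fin.last m))) fun i => Set.Ioo (y i.castSucc) (y i.succ)

theorem interlacing_eq_pi (y : Fin (m + 1) → ℝ) : interlacing y = Set.univ.pi (gap y) := by
  ext x
  simp only [interlacing, Set.mem_ofPred_eq, Set.mem_univ_pi]
  constructor
  · rintro ⟨h1, h2⟩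
    refine Fin.lastCases ?_ fun i => ?_
    · simpa [gap] using h1 _
    · simpa [gap] using ⟨h1 _, h2 i.castSucc i.succ (by simp)⟩
  · intro h
    constructor
    · refine Fin.lastCases ?_ fun i => ?_
      · simpa [gap] using h (Fin.last m)
      · have := h i.castSucc
        simp only [gap, Fin.lastCases_castSucc] at this
        exact this.1
    · intro i j hij
      have hi : (i : ℕ) < m := by have := j.isLt; omega
      obtain ⟨i, rfl⟩ : ∃ i' : Fin m, i = i'.castSucc := ⟨⟨i, hi⟩, rfl⟩
      obtain rfl : j = i.succ := Fin.ext (by simpa using hij.symm)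
      have := h i.castSucc
      simp only [gap, Fin.lastCases_castSucc] at this
      exact this.2

theorem measurableSet_gap (y : Fin (m + 1) → ℝ) (i : Fin (m + 1)) : MeasurableSet (gap y i) := by
  refine Fin.lastCases ?_ (fun i => ?_) i
  · simp [gap]
  · simp [gap]

theorem measurableSet_interlacing (y : Fin (m + 1) → ℝ) : MeasurableSet (interlacing y) := by
  rw [interlacing_eq_pi]
  exact MeasurableSet.univ_pi (measurableSet_gap y)

theorem volume_restrict_interlacing (y : Fin (m + 1) → ℝ) :
    volume.restrict (interlacing y) = Measure.pi fun i => volume.restrict (gap y i) := by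
  rw [interlacing_eq_pi, volume_pi, Measure.restrict_pi_pi]

theorem gap_subset (y : Fin (m + 1) → ℝ) (i : Fin (m + 1)) : gap y i ⊆ Set.Ioi (y i) := by
  refine Fin.lastCases ?_ (fun i => ?_) i
  · simp [gap]
  · simpa [gap] using Set.Ioo_subset_Ioi_self

/-- Exhibits the matrix of gap integrals as the row differences of the matrix of tail integrals; the
last gap is already a tail. -/
theorem setIntegral_gap_castSucc (hy : StrictMono y) {g : ℝ → ℝ}
    (hg : ∀ i, IntegrableOn g (Set.Ioi (y i))) (i : Fin m) :
    ∫ t in gap y i.castSucc, g t =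
      (∫ t in Set.Ioi (y i.castSucc), g t) - ∫ t in Set.Ioi (y i.succ), g t := by
  have h := hy (Fin.castSucc_lt_succ (i := i))
  simp only [gap, Fin.lastCases_castSucc]
  rw [← integral_Ioc_eq_integral_Ioo, ← Set.Ioc_union_Ioi_eq_Ioi h.le,
    setIntegral_union (Set.Ioc_disjoint_Ioi le_rfl) measurableSet_Ioi
      ((hg i.castSucc).mono_set Set.Ioc_subset_Ioi_self) (hg _)]
  ring

variable {μ : Fin (m + 1) → ℕ} {s : ℕ}

/-- Absorbing x_i^{-s} into row i keeps each row a function of a single coordinate, as integration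
against a product measure requires. -/
theorem prod_inv_pow_mul_det (x : Fin (m + 1) → ℝ) :
    (∏ i, x i)⁻¹ ^ s * (Matrix.of fun i j => x i ^ μ j).det =
      (Matrix.of fun i j => x i ^ μ j * (x i)⁻¹ ^ s).det := by
  rw [← Finset.prod_inv_distrib, ← Finset.prod_pow, ← Matrix.det_mul_column]
  congr 1
  ext i j
  simp [mul_comm]

theorem integrableOn_interlacing_moment (hy0 : ∀ i, 0 < y i) (hs : ∀ j, μ j + 1 < s) :
    IntegrableOn (fun x : Fin (m + 1) → ℝ =>
      (∏ i, x i)⁻¹ ^ s * (Matrix.of fun i j => x i ^ μ j).det) (interlacing y) := by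
  rw [IntegrableOn, volume_restrict_interlacing]
  simp only [prod_inv_pow_mul_det]
  exact integrable_det_pi (G := fun j t => t ^ μ j * t⁻¹ ^ s) fun i j =>
    (integrableOn_pow_mul_inv_pow (hy0 i) (hs j)).mono_set (gap_subset y i)

/-- The moments of an alternant over the interlacing domain. -/
theorem integral_interlacing_moment (hy0 : ∀ i, 0 < y i) (hy : StrictMono y)
    (hs : ∀ j, μ j + 1 < s) :
    ∫ x in interlacing y, (∏ i, x i)⁻¹ ^ s * (Matrix.of fun i j => x i ^ μ j).det =
      (∏ i, y i) * (∏ i, y i)⁻¹ ^ s * (Matrix.of fun i j => y i ^ μ j).det *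
        ∏ j, ((s : ℝ) - 1 - μ j)⁻¹ := by
  have hint : ∀ i j, IntegrableOn (fun t : ℝ => t ^ μ j * t⁻¹ ^ s) (Set.Ioi (y i)) := fun i j =>
    integrableOn_pow_mul_inv_pow (hy0 i) (hs j)
  rw [volume_restrict_interlacing]
  simp only [prod_inv_pow_mul_det]
  rw [integral_det_pi (G := fun j t => t ^ μ j * t⁻¹ ^ s) fun i j =>
    (hint i j).mono_set (gap_subset y i)]
  -- Undo the row differences. Each tail integral is a factor depending on y_i, times y_i^{μ_j},
  -- times a factor depending on j, so row and column scalings come out and leave a_μ(y).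
  rw [det_sub_next_row (A := Matrix.of fun i j => ∫ t in Set.Ioi (y i), t ^ μ j * t⁻¹ ^ s)]
  · simp only [integral_pow_mul_inv_pow (hy0 _) (hs _)]
    rw [← Finset.prod_inv_distrib, ← Finset.prod_pow, ← Finset.prod_mul_distrib,
      ← Matrix.det_mul_column, mul_comm, ← Matrix.det_mul_row]
    congr 1
    ext i j
    simp only [Matrix.of_apply]
    ring
  · intro j
    simp [gap]
  · intro i j
    exact setIntegral_gap_castSucc hy (fun i => hint i j) i

theorem prod_lt_prod_of_mem_interlacing (hy0 : ∀ i, 0 < y i) {x : Fin (m + 1) → ℝ}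
    (hx : x ∈ interlacing y) : ∏ i, y i < ∏ i, x i :=
  Finset.prod_lt_prod_of_nonempty (fun i _ => hy0 i) (fun i _ => hx.1 i) Finset.univ_nonempty

end Interlacing

/-! ### Moments on [0, 1] determine integrals of continuous functions -/

section Weierstrass

variable {α β : Type*} [MeasurableSpace α] [MeasurableSpace β] {ν : Measure α} {ρ : Measure β}
  {T g : α → ℝ} {U e : β → ℝ} {k : ℝ → ℝ}

theorem integrable_comp_mul (hg : Integrable g ν) (hT : AEMeasurable T ν)
    (hT1 : ∀ᵐ a ∂ν, T a ∈ Set.Icc (0 : ℝ) 1) (hk : ContinuousOn k (Set.Icc 0 1)) :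
    Integrable (fun a => k (T a) * g a) ν := by
  -- Since `k` is continuous only on [0, 1], it is extended by constants to a function continuous on
  -- the line, which gives measurability of the composition and a global bound.
  let k' : ℝ → ℝ := Set.IccExtend (zero_le_one' ℝ) (Set.domRestrict (Set.Icc 0 1) k)
  have hk' : Continuous k' := (continuousOn_iff_continuous_domRestrict.1 hk).Icc_extend'
  obtain ⟨C, hC⟩ := isCompact_Icc.exists_bound_of_continuousOn hk
  have h : Integrable (fun a => k' (T a) * g a) ν := by
    refine hg.bdd_mul (c := C) (hk'.measurable.comp_aemeasurable hT).aestronglyMeasurable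
      (ae_of_all _ fun a => ?_)
    exact hC _ (Set.projIcc (0 : ℝ) 1 _ (T a)).2
  refine h.congr ?_
  filter_upwards [hT1] with a ha
  simp only [k', Set.IccExtend_of_mem _ _ ha,
    Set.domRestrict_apply _ _ (⟨T a, ha⟩ : Set.Icc (0 : ℝ) 1)]

theorem abs_integral_comp_mul_sub_le (hg : Integrable g ν) (hT : AEMeasurable T ν)
    (hT1 : ∀ᵐ a ∂ν, T a ∈ Set.Icc (0 : ℝ) 1) (hk : ContinuousOn k (Set.Icc 0 1))
    {p : ℝ → ℝ} (hp : ContinuousOn p (Set.Icc 0 1)) {ε : ℝ}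
    (h : ∀ t ∈ Set.Icc (0 : ℝ) 1, |p t - k t| < ε) :
    |∫ a, p (T a) * g a ∂ν - ∫ a, k (T a) * g a ∂ν| ≤ ε * ∫ a, |g a| ∂ν := by
  rw [← integral_sub (integrable_comp_mul hg hT hT1 hp) (integrable_comp_mul hg hT hT1 hk),
    ← integral_const_mul, ← Real.norm_eq_abs]
  refine norm_integral_le_of_norm_le (hg.abs.const_mul ε) ?_
  filter_upwards [hT1] with a ha
  rw [← sub_mul, norm_mul, Real.norm_eq_abs, Real.norm_eq_abs]
  exact mul_le_mul_of_nonneg_right (h _ ha).le (abs_nonneg _)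

theorem integral_polynomial_comp_mul (hg : Integrable g ν) (hT : AEMeasurable T ν)
    (hT1 : ∀ᵐ a ∂ν, T a ∈ Set.Icc (0 : ℝ) 1) (p : Polynomial ℝ) :
    ∫ a, p.eval (T a) * g a ∂ν = p.sum fun i c => c * ∫ a, T a ^ i * g a ∂ν := by
  simp only [Polynomial.eval_eq_sum, Polynomial.sum, Finset.sum_mul, mul_assoc]
  rw [integral_finsetSum]
  · simp only [integral_const_mul]
  · intro i _
    exact (integrable_comp_mul hg hT hT1 (continuous_pow i).continuousOn).const_mul _

/-- Two signed densities on `[0, 1]` with the same moments have the same integrals against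
continuous functions. -/
theorem integral_comp_mul_eq_of_moments (hg : Integrable g ν) (hT : AEMeasurable T ν)
    (hT1 : ∀ᵐ a ∂ν, T a ∈ Set.Icc (0 : ℝ) 1) (he : Integrable e ρ) (hU : AEMeasurable U ρ)
    (hU1 : ∀ᵐ b ∂ρ, U b ∈ Set.Icc (0 : ℝ) 1)
    (hmom : ∀ i : ℕ, ∫ a, T a ^ i * g a ∂ν = ∫ b, U b ^ i * e b ∂ρ)
    (hk : ContinuousOn k (Set.Icc 0 1)) :
    ∫ a, k (T a) * g a ∂ν = ∫ b, k (U b) * e b ∂ρ := by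
  -- Replace `k` by a polynomial within ε on [0, 1]: its two integrals agree by the moment
  -- hypothesis, and each replacement costs at most ε times an L¹ norm.
  have hle : ∀ ε : ℝ, 0 < ε → |∫ a, k (T a) * g a ∂ν - ∫ b, k (U b) * e b ∂ρ| ≤
      ε * (∫ a, |g a| ∂ν + ∫ b, |e b| ∂ρ) := by
    intro ε hε
    obtain ⟨p, hp⟩ := exists_polynomial_near_of_continuousOn 0 1 k hk ε hε
    have h1 := abs_integral_comp_mul_sub_le hg hT hT1 hk p.continuousOn hp
    have h2 := abs_integral_comp_mul_sub_le he hU hU1 hk p.continuousOn hp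
    have h3 : ∫ a, p.eval (T a) * g a ∂ν = ∫ b, p.eval (U b) * e b ∂ρ := by
      rw [integral_polynomial_comp_mul hg hT hT1, integral_polynomial_comp_mul he hU hU1]
      simp only [hmom]
    rw [h3, abs_sub_comm] at h1
    rw [mul_add]
    exact (abs_sub_le _ _ _).trans (add_le_add h1 h2)
  have hlim : Tendsto (fun ε : ℝ => ε * (∫ a, |g a| ∂ν + ∫ b, |e b| ∂ρ)) (𝓝[>] 0) (𝓝 0) := by
    have : Continuous fun ε : ℝ => ε * (∫ a, |g a| ∂ν + ∫ b, |e b| ∂ρ) := by fun_prop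
    simpa using (this.tendsto 0).mono_left nhdsWithin_le_nhds
  have h0 := ge_of_tendsto hlim (by filter_upwards [self_mem_nhdsWithin] with ε hε using hle ε hε)
  exact sub_eq_zero.1 (abs_nonpos_iff.1 h0)

end Weierstrass

theorem HasCompactSupport.exists_eq_zero_of_lt_abs {h : ℝ → ℝ} (hc : HasCompactSupport h) :
    ∃ R : ℝ, 0 < R ∧ ∀ t, R < |t| → h t = 0 := by
  obtain ⟨R, hR, hsub⟩ := hc.isCompact.isBounded.subset_closedBall_lt 0 0
  refine ⟨R, hR, fun t ht => image_eq_zero_of_notMem_tsupport fun hmem => ?_⟩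
  have := hsub hmem
  rw [mem_closedBall_zero_iff, Real.norm_eq_abs] at this
  exact absurd ht (not_lt.2 this)

/-- Near 0 the point u⁻¹ leaves the support of `h`, so the function vanishes there; at 0 itself 0⁻¹
= 0, and `hs` makes the value 0. -/
theorem continuous_inv_pow_mul_comp_inv {h : ℝ → ℝ} (hh : Continuous h)
    (hc : HasCompactSupport h) {s : ℕ} (hs : s ≠ 0) :
    Continuous fun u : ℝ => u⁻¹ ^ s * h u⁻¹ := by
  obtain ⟨R, hR, hR0⟩ := HasCompactSupport.exists_eq_zero_of_lt_abs hc
  rw [continuous_iff_continuousAt]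
  intro u
  rcases eq_or_ne u 0 with rfl | hu
  · refine (continuousAt_const (y := (0 : ℝ))).congr ?_
    filter_upwards [Metric.ball_mem_nhds (0 : ℝ) (inv_pos.2 hR)] with v hv
    rcases eq_or_ne v 0 with rfl | hv0
    · simp [hs]
    · rw [hR0, mul_zero]
      rw [mem_ball_zero_iff, Real.norm_eq_abs] at hv
      rw [abs_inv]
      exact (lt_inv_comm₀ (abs_pos.2 hv0) hR).1 hv
  · exact ((continuousAt_inv₀ hu).pow s).mul (hh.continuousAt.comp (continuousAt_inv₀ hu))

/-! ### The pushforward of an alternant under the product of coordinates -/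

section Pushforward

variable {m : ℕ} {y : Fin (m + 1) → ℝ} {μ : Fin (m + 1) → ℕ} {h : ℝ → ℝ}

/-- An exponent for which all moments of the alternant `a_μ` converge. -/
def momentOrder (μ : Fin (m + 1) → ℕ) : ℕ := ∑ j, μ j + 2

theorem lt_momentOrder_add (j : Fin (m + 1)) (i : ℕ) : μ j + 1 < momentOrder μ + i := by
  have := Finset.single_le_sum (f := μ) (fun _ _ => Nat.zero_le _) (Finset.mem_univ j)
  rw [momentOrder]
  omega

theorem ae_prod_div_prod_mem_Icc (hy0 : ∀ i, 0 < y i) :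
    ∀ᵐ x ∂volume.restrict (interlacing y),
      ((∏ i, y i) * (∏ i, x i)⁻¹) ∈ Set.Icc (0 : ℝ) 1 := by
  refine (ae_restrict_iff' (measurableSet_interlacing y)).2 (ae_of_all _ fun x hx => ?_)
  have hY : 0 < ∏ i, y i := Finset.prod_pos fun i _ => hy0 i
  have hlt := prod_lt_prod_of_mem_interlacing hy0 hx
  rw [← div_eq_mul_inv]
  exact ⟨(div_pos hY (hY.trans hlt)).le, (div_le_one (hY.trans hlt)).2 hlt.le⟩

theorem measurable_prod_div_prod (y : Fin (m + 1) → ℝ) :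
    Measurable fun x : Fin (m + 1) → ℝ => (∏ i, y i) * (∏ i, x i)⁻¹ := by
  fun_prop

theorem integrableOn_momentOrder (hy0 : ∀ i, 0 < y i) :
    IntegrableOn (fun x : Fin (m + 1) → ℝ => ((∏ i, y i) * (∏ i, x i)⁻¹) ^ momentOrder μ *
      (Matrix.of fun i j => x i ^ μ j).det) (interlacing y) := by
  simp only [mul_pow, mul_assoc]
  exact (integrableOn_interlacing_moment hy0 fun j => lt_momentOrder_add j 0).integrable.const_mul _

/-- With T = ∏ y_i / ∏ x_i in (0, 1], the integrand splits into a function of T that extends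
continuously to [0, 1] and a density T^s d. For s = `momentOrder μ` and d = a_μ(x) the density is
integrable, though a_μ alone need not be. -/
theorem comp_prod_div_mul_eq (hy0 : ∀ i, 0 < y i) {x : Fin (m + 1) → ℝ} (hx : x ∈ interlacing y)
    (h : ℝ → ℝ) (s : ℕ) (d : ℝ) :
    h ((∏ i, x i) / ∏ i, y i) * d = (((∏ i, y i) * (∏ i, x i)⁻¹)⁻¹ ^ s *
      h ((∏ i, y i) * (∏ i, x i)⁻¹)⁻¹) * (((∏ i, y i) * (∏ i, x i)⁻¹) ^ s * d) := by
  have hY : 0 < ∏ i, y i := Finset.prod_pos fun i _ => hy0 i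
  have hX := hY.trans (prod_lt_prod_of_mem_interlacing hy0 hx)
  have h1 : ((∏ i, y i) * (∏ i, x i)⁻¹)⁻¹ = (∏ i, x i) / ∏ i, y i := by
    rw [mul_inv, inv_inv, div_eq_mul_inv, mul_comm]
  have h2 : ((∏ i, y i) * (∏ i, x i)⁻¹)⁻¹ ^ s * ((∏ i, y i) * (∏ i, x i)⁻¹) ^ s = 1 := by
    rw [← mul_pow, inv_mul_cancel₀ (mul_pos hY (inv_pos.2 hX)).ne', one_pow]
  rw [← h1]
  linear_combination (-(h ((∏ i, y i) * (∏ i, x i)⁻¹)⁻¹ * d)) * h2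

theorem integrableOn_comp_prod_mul_det (hy0 : ∀ i, 0 < y i) (hh : Continuous h)
    (hc : HasCompactSupport h) :
    IntegrableOn (fun x : Fin (m + 1) → ℝ => h ((∏ i, x i) / ∏ i, y i) *
      (Matrix.of fun i j => x i ^ μ j).det) (interlacing y) := by
  refine IntegrableOn.congr_fun (integrable_comp_mul (integrableOn_momentOrder (μ := μ) hy0)
    (measurable_prod_div_prod y).aemeasurable (ae_prod_div_prod_mem_Icc hy0)
    (continuous_inv_pow_mul_comp_inv hh hc (s := momentOrder μ) (by simp [momentOrder])).continuousOn)
    (fun x hx => (comp_prod_div_mul_eq hy0 hx h _ _).symm) (measurableSet_interlacing y)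

/-- The distribution of `∏ x_i / ∏ y_i` under the signed density `a_μ` on the interlacing domain. -/
theorem integral_comp_prod_mul_det (hy0 : ∀ i, 0 < y i) (hy : StrictMono y)
    (hμ : Function.Injective μ) (hh : Continuous h) (hc : HasCompactSupport h) :
    ∫ x in interlacing y, h ((∏ i, x i) / ∏ i, y i) * (Matrix.of fun i j => x i ^ μ j).det =
      (∏ i, y i) * (Matrix.of fun i j => y i ^ μ j).det *
        ∫ w in Set.Ioi 1, h w * dividedPow μ w := by
  set S := momentOrder μ with hS
  have hY : 0 < ∏ i, y i := Finset.prod_pos fun i _ => hy0 i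
  have hs : ∀ i j, μ j + 1 < S + i := fun i j => lt_momentOrder_add j i
  rw [setIntegral_congr_fun (measurableSet_interlacing y)
    fun x hx => comp_prod_div_mul_eq hy0 hx h S _]
  set c : ℝ := (∏ i, y i) * (Matrix.of fun i j => y i ^ μ j).det with hcdef
  -- Compare T = ∏ y_i / ∏ x_i on Ω with U = 1/w on w > 1, both densities damped by the power S. The
  -- i-th moments are then the negative moments of order S + i computed above.
  have key := integral_comp_mul_eq_of_moments (ρ := volume.restrict (Set.Ioi (1 : ℝ)))
    (U := fun w => w⁻¹) (e := fun w => c * (w⁻¹ ^ S * dividedPow μ w))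
    (integrableOn_momentOrder (μ := μ) hy0)
    (measurable_prod_div_prod y).aemeasurable (ae_prod_div_prod_mem_Icc hy0)
    ((integrableOn_inv_pow_mul_dividedPow fun j => hs 0 j).integrable.const_mul c)
    measurable_inv.aemeasurable
    ((ae_restrict_iff' measurableSet_Ioi).2 (ae_of_all _ fun w (hw : 1 < w) =>
      ⟨inv_nonneg.2 (by linarith), inv_le_one_of_one_le₀ hw.le⟩))
    (fun i => by
      have h1 : ∀ x : Fin (m + 1) → ℝ, ((∏ i, y i) * (∏ i, x i)⁻¹) ^ i *
          (((∏ i, y i) * (∏ i, x i)⁻¹) ^ S * (Matrix.of fun i j => x i ^ μ j).det) =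
          (∏ i, y i) ^ (S + i) *
            ((∏ i, x i)⁻¹ ^ (S + i) * (Matrix.of fun i j => x i ^ μ j).det) := fun x => by ring
      have h2 : ∀ w : ℝ, w⁻¹ ^ i * (c * (w⁻¹ ^ S * dividedPow μ w)) =
          c * (w⁻¹ ^ (S + i) * dividedPow μ w) := fun w => by ring
      have h3 : (∏ i, y i) ^ (S + i) * (∏ i, y i)⁻¹ ^ (S + i) = 1 := by
        rw [← mul_pow, mul_inv_cancel₀ hY.ne', one_pow]
      simp only [← hS, h1, h2]
      rw [integral_const_mul, integral_const_mul, integral_interlacing_moment hy0 hy (hs i),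
        integral_inv_pow_mul_dividedPow hμ (hs i)]
      linear_combination (c * ∏ j, (((S + i : ℕ) : ℝ) - 1 - μ j)⁻¹) * h3)
    (continuous_inv_pow_mul_comp_inv hh hc (s := S) (by simp [hS, momentOrder])).continuousOn
  rw [key, ← integral_const_mul]
  refine setIntegral_congr_fun measurableSet_Ioi fun w (hw : 1 < w) => ?_
  have hw1 : w ^ S * w⁻¹ ^ S = 1 := by
    rw [← mul_pow, mul_inv_cancel₀ (by linarith), one_pow]
  simp only [inv_inv]
  linear_combination (h w * c * dividedPow μ w) * hw1

end Pushforward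

/-! ### Delta-function integrals -/

/-- Approximate identities concentrate at an interior point of the half-line. -/
theorem tendsto_integral_approx_delta {φ k : ℝ → ℝ} (hφ : Continuous φ)
    (hc : HasCompactSupport φ) (h1 : ∫ t, φ t = 1) (hk : Continuous k) {z Y : ℝ} (hz : 1 < z)
    (hY : 0 < Y) :
    Tendsto (fun ε : ℝ => Y * ∫ w in Set.Ioi 1, ε⁻¹ * φ (Y * (w - z) / ε) * k w) (𝓝[>] 0)
      (𝓝 (k z)) := by
  -- After the substitution u = Y (w - z) / ε the integral depends continuously on ε, and its value
  -- at ε = 0 is k(z) ∫ φ.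
  have hcont : Continuous fun ε : ℝ => ∫ u in tsupport φ, φ u * k (z + ε / Y * u) :=
    continuous_parametric_integral_of_continuous
      (by simp only [Function.uncurry_def]; fun_prop) hc.isCompact
  have hset : ∀ ε : ℝ, ∫ u in tsupport φ, φ u * k (z + ε / Y * u) =
      ∫ u, φ u * k (z + ε / Y * u) := fun ε =>
    setIntegral_eq_integral_of_forall_compl_eq_zero fun u hu => by
      rw [image_eq_zero_of_notMem_tsupport hu, zero_mul]
  simp only [hset] at hcont
  have h0 := (hcont.tendsto 0).mono_left (nhdsWithin_le_nhds (s := Set.Ioi 0))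
  simp only [zero_div, zero_mul, add_zero, integral_mul_const, h1, one_mul] at h0
  refine h0.congr' ?_
  obtain ⟨R, hR, hR0⟩ := HasCompactSupport.exists_eq_zero_of_lt_abs hc
  -- For ε below this bound the rescaled φ vanishes for w ≤ 1, so the half-line may be replaced by
  -- the whole line.
  have hδ : 0 < Y * (z - 1) / R := div_pos (mul_pos hY (by linarith)) hR
  filter_upwards [Ioo_mem_nhdsGT hδ] with ε hε
  have hε0 : 0 < ε := hε.1
  have hεR : R < Y * (z - 1) / ε := (lt_div_comm₀ hR hε0).2 hε.2
  rw [setIntegral_eq_integral_of_forall_compl_eq_zero fun w hw => ?_]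
  · have hsub : ∀ w : ℝ, ε⁻¹ * φ (Y * (w - z) / ε) * k w =
        ε⁻¹ * (fun u => φ u * k (z + ε / Y * u)) (Y / ε * (w - z)) := by
      intro w
      have e1 : Y / ε * (w - z) = Y * (w - z) / ε := by ring
      have e2 : z + ε / Y * (Y * (w - z) / ε) = w := by field_simp; ring
      simp only [e1, e2, mul_assoc]
    simp only [hsub, integral_const_mul]
    rw [integral_sub_right_eq_self (fun v => (fun u => φ u * k (z + ε / Y * u)) (Y / ε * v)) z,
      Measure.integral_comp_mul_left (fun u => φ u * k (z + ε / Y * u)),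
      abs_of_pos (inv_pos.2 (div_pos hY hε0)), smul_eq_mul]
    field_simp
  · have hw1 : w ≤ 1 := not_lt.1 hw
    have hle : Y * (z - 1) / ε ≤ |Y * (w - z) / ε| := by
      rw [abs_div, abs_of_pos hε0, abs_mul, abs_of_pos hY, abs_sub_comm,
        abs_of_nonneg (by linarith : 0 ≤ z - w)]
      gcongr
    rw [hR0 _ (hεR.trans_le hle), mul_zero, zero_mul]

section DeltaIntegral

variable {n : ℕ} {Ω : Set (Fin n → ℝ)} {g : (Fin n → ℝ) → ℝ} {F G : (Fin n → ℝ) → ℂ} {I J : ℂ}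

theorem HasDeltaIntegral.add (hF : HasDeltaIntegral Ω g F I) (hG : HasDeltaIntegral Ω g G J) :
    HasDeltaIntegral Ω g (fun x => F x + G x) (I + J) := by
  intro φ h1 h2 h3
  obtain ⟨hF1, hF2⟩ := hF φ h1 h2 h3
  obtain ⟨hG1, hG2⟩ := hG φ h1 h2 h3
  simp only [mul_add]
  refine ⟨?_, (hF2.add hG2).congr' ?_⟩
  · filter_upwards [hF1, hG1] with ε hFε hGε using hFε.add hGε
  · filter_upwards [hF1, hG1] with ε hFε hGε using (integral_add hFε hGε).symm

theorem HasDeltaIntegral.const_mul (hF : HasDeltaIntegral Ω g F I) (c : ℂ) :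
    HasDeltaIntegral Ω g (fun x => c * F x) (c * I) := by
  intro φ h1 h2 h3
  obtain ⟨hF1, hF2⟩ := hF φ h1 h2 h3
  simp only [mul_left_comm _ c, integral_const_mul]
  exact ⟨hF1.mono fun ε hε => hε.const_mul c, hF2.const_mul c⟩

theorem HasDeltaIntegral.zero : HasDeltaIntegral Ω g (fun _ => 0) 0 := by
  intro φ _ _ _
  simp

end DeltaIntegral

/-- In terms of w = ∏ x_i / Y the delta function is δ(Y (w - z)) = Y⁻¹ δ(w - z); this Y⁻¹ cancels
the factor Y of the pushforward density. -/
theorem hasDeltaIntegral_det {m : ℕ} {y : Fin (m + 1) → ℝ} (hy0 : ∀ i, 0 < y i)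
    (hy : StrictMono y) {μ : Fin (m + 1) → ℕ} (hμ : Function.Injective μ) {z : ℝ} (hz : 1 < z) :
    HasDeltaIntegral (interlacing y) (fun x => (∏ i, x i) - z * ∏ i, y i)
      (fun x => (((Matrix.of fun i j => x i ^ μ j).det : ℝ) : ℂ))
      (((Matrix.of fun i j => y i ^ μ j).det * dividedPow μ z : ℝ) : ℂ) := by
  intro φ hφ hc h1
  have hY : 0 < ∏ i, y i := Finset.prod_pos fun i _ => hy0 i
  have heq : ∀ (ε : ℝ) (x : Fin (m + 1) → ℝ), ε⁻¹ * φ (((∏ i, x i) - z * ∏ i, y i) / ε) =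
      (fun w => ε⁻¹ * φ ((∏ i, y i) * (w - z) / ε)) ((∏ i, x i) / ∏ i, y i) := by
    intro ε x
    simp only [mul_sub, mul_div_cancel₀ _ hY.ne', mul_comm z]
  have hcomp : ∀ ε : ℝ, 0 < ε → HasCompactSupport fun w => ε⁻¹ * φ ((∏ i, y i) * (w - z) / ε) := by
    intro ε hε
    obtain ⟨R, hR, hR0⟩ := HasCompactSupport.exists_eq_zero_of_lt_abs hc
    refine HasCompactSupport.intro (isCompact_closedBall z (R * ε / ∏ i, y i)) fun w hw => ?_
    rw [Metric.mem_closedBall, Real.dist_eq, not_le, div_lt_iff₀ hY] at hw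
    rw [hR0, mul_zero]
    rw [abs_div, abs_of_pos hε, abs_mul, abs_of_pos hY, lt_div_iff₀ hε]
    linarith
  have hcont : ∀ ε : ℝ, Continuous fun w => ε⁻¹ * φ ((∏ i, y i) * (w - z) / ε) := by
    intro ε; fun_prop
  simp only [← Complex.ofReal_mul, heq]
  constructor
  · filter_upwards [self_mem_nhdsWithin] with ε hε
    exact (integrableOn_comp_prod_mul_det hy0 (hcont ε) (hcomp ε hε)).integrable.ofReal
  · simp only [integral_complex_ofReal]
    refine (Complex.continuous_ofReal.tendsto _).comp ?_
    refine ((tendsto_integral_approx_delta hφ hc h1 (continuous_dividedPow (μ := μ)) hz hY).const_mul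
      (Matrix.of fun i j => y i ^ μ j).det).congr' ?_
    filter_upwards [self_mem_nhdsWithin] with ε hε
    rw [integral_comp_prod_mul_det hy0 hy hμ (hcont ε) (hcomp ε hε)]
    ring

/-! ### From alternants to the operator Q_z -/

section Schur

variable {m : ℕ}

theorem ofReal_vandermondeProd_mul_eval_schurPoly (l : Part (m + 1)) (x : Fin (m + 1) → ℝ) :
    ((vandermondeProd x : ℝ) : ℂ) * eval (fun i => (x i : ℂ)) (schurPoly l) =
      (((Matrix.of fun i j => x i ^ shifted l j).det : ℝ) : ℂ) := by
  have h : ((vandermondeProd x : ℝ) : ℂ) = vandermondeProd fun i => (x i : ℂ) := by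
    simp [vandermondeProd]
  rw [h, vandermondeProd_mul_eval_schurPoly, ← Complex.ofRealHom_eq_coe, RingHom.map_det]
  congr 1
  ext i j
  simp

theorem ofReal_dividedPow (μ : Fin (m + 1) → ℕ) (z : ℝ) :
    ((dividedPow μ z : ℝ) : ℂ) = dividedPow μ (z : ℂ) := by
  simp [dividedPow, Lagrange.nodalWeight]

theorem Qop_schurSym {n : ℕ} (z : ℂ) (l : Part n) :
    Qop n z (schurSym l) = (qPoly l).eval z • schurSym l := by
  have := (schurBasis n).constr_basis ℂ (fun l => (qPoly l).eval z • schurSym l) l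
  simpa [schurBasis, Qop] using this

/-- Here the alternant formula meets the formula for the eigenvalue q_λ(z). The prefactor of the
theorem is moved to the other side, so that the value of the integral is visibly linear in f. -/
theorem hasDeltaIntegral_schurSym {y : Fin (m + 1) → ℝ} (hy0 : ∀ i, 0 < y i)
    (hy : StrictMono y) {z : ℝ} (hz : 1 < z) (l : Part (m + 1)) :
    HasDeltaIntegral (interlacing y) (fun x => (∏ i, x i) - z * ∏ i, y i)
      (fun x => ((vandermondeProd x : ℝ) : ℂ) *
        eval (fun i => (x i : ℂ)) (schurSym l : MvPolynomial (Fin (m + 1)) ℂ))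
      (((z : ℂ) - 1) ^ m * ((vandermondeProd y : ℝ) : ℂ) / m.factorial *
        eval (fun i => (y i : ℂ))
          (Qop (m + 1) z (schurSym l) : MvPolynomial (Fin (m + 1)) ℂ)) := by
  have h := hasDeltaIntegral_det hy0 hy (shifted_strictAnti l).injective hz
  have hm : (m.factorial : ℂ) ≠ 0 := by exact_mod_cast m.factorial_ne_zero
  have hq := qPoly_eval_mul l (z : ℂ)
  have hV := ofReal_vandermondeProd_mul_eval_schurPoly l y
  rw [Complex.ofReal_mul, ofReal_dividedPow, ← hV] at h
  simp only [← ofReal_vandermondeProd_mul_eval_schurPoly] at h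
  convert h using 1
  · rfl
  · rw [Qop_schurSym]
    simp only [schurSym, Subalgebra.coe_smul, smul_eval]
    field_simp
    linear_combination (((vandermondeProd y : ℝ) : ℂ) *
      eval (fun i => (y i : ℂ)) (schurPoly l)) * hq

/-- The integrand and the value are both linear in f, so the Schur case extends along the spanning
set. -/
theorem hasDeltaIntegral_Qop {y : Fin (m + 1) → ℝ} (hy0 : ∀ i, 0 < y i)
    (hy : StrictMono y) {z : ℝ} (hz : 1 < z) (f : Sym (m + 1)) :
    HasDeltaIntegral (interlacing y) (fun x => (∏ i, x i) - z * ∏ i, y i)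
      (fun x => ((vandermondeProd x : ℝ) : ℂ) *
        eval (fun i => (x i : ℂ)) (f : MvPolynomial (Fin (m + 1)) ℂ))
      (((z : ℂ) - 1) ^ m * ((vandermondeProd y : ℝ) : ℂ) / m.factorial *
        eval (fun i => (y i : ℂ)) (Qop (m + 1) z f : MvPolynomial (Fin (m + 1)) ℂ)) := by
  induction schurSym_span (m + 1) (Submodule.mem_top (x := f)) using Submodule.span_induction with
  | mem f hf =>
    obtain ⟨l, rfl⟩ := hf
    exact hasDeltaIntegral_schurSym hy0 hy hz l
  | zero => simpa using HasDeltaIntegral.zero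
  | add f g _ _ hf hg => simpa [mul_add] using hf.add hg
  | smul c f _ hf => simpa [mul_left_comm _ c] using hf.const_mul c

end Schur

end SchurQ

theorem mainTheorem1 (n : ℕ) (hn : 1 ≤ n) (z : ℝ) (hz : 1 < z)
    (y : Fin n → ℝ) (hy0 : ∀ i, 0 < y i) (hy : StrictMono y) (f : SchurQ.Sym n) :
    ∃ I : ℂ,
      SchurQ.HasDeltaIntegral (SchurQ.interlacing y) (fun x => (∏ i, x i) - z * ∏ i, y i)
        (fun x => ((SchurQ.vandermondeProd x : ℝ) : ℂ) *
          MvPolynomial.eval (fun i => (x i : ℂ)) (f : MvPolynomial (Fin n) ℂ)) I ∧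
      MvPolynomial.eval (fun i => (y i : ℂ))
          (SchurQ.Qop n (z : ℂ) f : MvPolynomial (Fin n) ℂ) =
        ((n - 1).factorial : ℂ) /
          (((z : ℂ) - 1) ^ (n - 1) * ((SchurQ.vandermondeProd y : ℝ) : ℂ)) * I := by
  obtain ⟨m, rfl⟩ : ∃ m, n = m + 1 := ⟨n - 1, by omega⟩
  refine ⟨_, SchurQ.hasDeltaIntegral_Qop hy0 hy hz f, ?_⟩
  have h1 : (z : ℂ) - 1 ≠ 0 := sub_ne_zero.2 (by exact_mod_cast hz.ne')
  have h2 : ((SchurQ.vandermondeProd y : ℝ) : ℂ) ≠ 0 :=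
    Complex.ofReal_ne_zero.2 (SchurQ.vandermondeProd_ne_zero hy.injective)
  have h3 : (m.factorial : ℂ) ≠ 0 := by exact_mod_cast m.factorial_ne_zero
  rw [Nat.add_sub_cancel]
  field_simp
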